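/- Let $k\ge 1$ and $t\ge 0$ be integers, and let $\lambda=(k^t)=(k,\dots,k)$ be the partition with $t$ parts equal to $k$. Let $P_\lambda$ be the poset whose elements are the cells $(a,b)$, $1\le a\le t$, $1\le b\le k$, of the Ferrers diagram of $\lambda$, with $(a,b)\preceq(a',b')$ if and only if $a'\le a$ and $b'\le b$. Let $$\mathcal{O}(P_\lambda)=\{x\in\mathbb{R}^{P_\lambda} : x_c\le x_d \text{ whenever } c\prec d,\ \text{and } 0\le x_c\le 1 \text{ for all } c\in P_\lambda\}$$ be its order polytope. For an integer $n\ge 0$ let $\mathrm{ehr}(\mathcal{O}(P_\lambda),n)=|n\mathcal{O}(P_\lambda)\cap\mathbb{Z}^{P_\lambda}|$ be the number of integer points in its $n$-th dilate. Then $\mathrm{ehr}(\mathcal{O}(P_\lambda),n)$ is given by a polynomial in $n$ with rational coefficients (the Ehrhart polynomial), and for every integer $n\ge 0$ the number of integer points and the value of this polynomial at $n$ are both equal to $$\prod_{i=0}^{k-1}\binom{n+t+k-1}{n+i}\,\frac{i!}{(n+t+k-i-1)^{k-i-1}},$$ where $(n+t+k-i-1)^{k-i-1}$ is an ordinary power,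 with $0^0=1$ (which occurs only for $n=t=0$, $i=k-1$). -/

import Mathlib

open scoped Pointwise Polynomial

/-- The lattice-point enumerator of a subset `Q` of `ℝ^ι`: the number of points of `ℤ^ι` that lie
in the dilate `n • Q`. -/
noncomputable def ehr {ι : Type*} (Q : Set (ι → ℝ)) (n : ℕ) : ℕ :=
  Set.ncard {z : ι → ℤ | (fun i => (z i : ℝ)) ∈ (n : ℝ) • Q}

/-- `p` is the Ehrhart polynomial of `Q`: it takes the value `ehr Q n` at every positive integer
`n` (so there is at most one such `p`). -/
def IsEhrhartPolynomial {ι : Type*} (Q : Set (ι → ℝ)) (p : ℚ[X]) : Prop :=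
  ∀ n : ℕ, 1 ≤ n → p.eval (n : ℚ) = (ehr Q n : ℚ)

/-- The order polytope of a poset `P`, in the space `ℝ^P` with one coordinate for each element. -/
def orderPolytope (P : Type*) [PartialOrder P] : Set (P → ℝ) :=
  {x | (∀ a b : P, a < b → x a ≤ x b) ∧ ∀ a : P, 0 ≤ x a ∧ x a ≤ 1}

/-- The Ferrers poset of a Young diagram: its elements are the cells `(i, j)` (row `i`, column `j`,
both counted from `0`), and `c` is below `d` when `d` lies weakly above and weakly to the left of
`c`. Thus the corner cell `(0, 0)` is the maximum. -/
abbrev FerrersPoset (μ : YoungDiagram) : Type :=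
  ({c : ℕ × ℕ // c ∈ μ})ᵒᵈ

/-- The Young diagram of the partition `(k^t) = (k, k, …, k)`, with `t` rows of length `k`. -/
def rectDiagram (k t : ℕ) : YoungDiagram :=
  YoungDiagram.ofRowLens (List.replicate t k) (List.pairwise_replicate_of_refl.sortedGE)

/-! Integer points of the `n`-th dilate are plane partitions in a `t × k × n` box. They correspond
to Gelfand–Tsetlin patterns with bottom row `0^t n^k`: interlacing freezes two corner triangles of
such a pattern at `0` and `n`, and the free entries form a `t × k` rectangle whose inequalities are
those of the poset (`ncard_boxLabellings`).

Patterns with bottom row `l` are counted by `det ((l i + i).choose j)`, since both sides satisfy the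
same recursion on deleting that row (`card_gtPatterns_eq_det`). This determinant is a Vandermonde
product divided by factorials. For `0^t n^k` it becomes a product of falling factorials of fixed
length `t`, hence polynomial in `n`; regrouping factorials gives the stated form. -/

/-- `x` is a Gelfand–Tsetlin pattern with `m` rows and bottom row `l`: row `r` has the entries
`x r i` for `i < r`, consecutive rows interlace, and all entries outside the triangle vanish. -/
def IsGTPattern (m : ℕ) (l : Fin m → ℕ) (x : ℕ → ℕ → ℕ) : Prop :=
  (∀ i : Fin m, x m i = l i) ∧ (∀ r i, m < r ∨ r ≤ i → x r i = 0) ∧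
    ∀ r i, i < r → r < m → x (r + 1) i ≤ x r i ∧ x r i ≤ x (r + 1) (i + 1)

open Classical in
/-- The finset of Gelfand–Tsetlin patterns with a given longest row. -/
noncomputable def gtPatterns : (m : ℕ) → (Fin m → ℕ) → Finset (ℕ → ℕ → ℕ)
  | 0, _ => {0}
  | m + 1, l =>
    (Fintype.piFinset fun i : Fin m => Finset.Icc (l i.castSucc) (l i.succ)).biUnion fun u =>
      (gtPatterns m u).image fun x =>
        Function.update x (m + 1) fun i => if h : i < m + 1 then l ⟨i, h⟩ else 0

theorem mem_gtPatterns (m : ℕ) (l : Fin m → ℕ) (x : ℕ → ℕ → ℕ) :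
    x ∈ gtPatterns m l ↔ IsGTPattern m l x := by
  induction m generalizing x with
  | zero =>
    simp only [gtPatterns, Finset.mem_singleton, IsGTPattern]
    constructor
    · rintro rfl
      simp
    · rintro ⟨-, h, -⟩
      funext r i
      exact h r i (by omega)
  | succ m ih =>
    simp only [gtPatterns, Finset.mem_biUnion, Fintype.mem_piFinset, Finset.mem_Icc,
      Finset.mem_image]
    constructor
    · rintro ⟨u, hu, y, hy, rfl⟩
      obtain ⟨h1, h2, h3⟩ := (ih u y).1 hy
      refine ⟨fun i => by simp [i.isLt, -Order.lt_add_one_iff], fun r i hri => ?_, fun r i hi hr => ?_⟩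
      · rcases eq_or_ne r (m + 1) with rfl | hne
        · rw [Function.update_self, dif_neg (by omega)]
        · rw [Function.update_of_ne hne]
          exact h2 r i (by omega)
      · rcases eq_or_ne r m with rfl | hne
        · have := hu ⟨i, hi⟩
          have e := h1 ⟨i, hi⟩
          rw [Function.update_self, Function.update_of_ne (by omega)]
          simp only [show i < r + 1 by omega, show i + 1 < r + 1 by omega, dif_pos]
          simp only at e
          rw [e]
          exact this
        · rw [Function.update_of_ne (by omega), Function.update_of_ne (by omega)]
          exact h3 r i hi (by omega)
    · rintro ⟨h1, h2, h3⟩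
      -- Row `m + 1` is zeroed because an `m`-row pattern must vanish outside its triangle.
      refine ⟨fun i => x m i, fun i => ?_, Function.update x (m + 1) 0, ?_, ?_⟩
      · have := h3 m i i.2 (by omega)
        have e1 := h1 i.castSucc
        have e2 := h1 i.succ
        simp only [Fin.val_castSucc, Fin.val_succ] at e1 e2
        rwa [← e1, ← e2]
      · rw [ih]
        refine ⟨fun i => by simp, fun r i hri => ?_, fun r i hi hr => ?_⟩
        · rcases eq_or_ne r (m + 1) with rfl | hne
          · simp
          · rw [Function.update_of_ne hne]
            exact h2 r i (by omega)
        · rw [Function.update_of_ne (by omega), Function.update_of_ne (by omega)]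
          exact h3 r i hi (by omega)
      · rw [Function.update_idem]
        conv_rhs => rw [← Function.update_eq_self (m + 1) x]
        congr 1
        funext i
        split_ifs with h
        · exact (h1 ⟨i, h⟩).symm
        · exact (h2 _ _ (by omega)).symm

open Classical in
theorem card_gtPatterns_succ (m : ℕ) (l : Fin (m + 1) → ℕ) :
    (gtPatterns (m + 1) l).card =
      ∑ u ∈ Fintype.piFinset fun i : Fin m => Finset.Icc (l i.castSucc) (l i.succ),
        (gtPatterns m u).card := by
  rw [gtPatterns, Finset.card_biUnion]
  · refine Finset.sum_congr rfl fun u _ => Finset.card_image_of_injOn fun x hx y hy hxy => ?_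
    have hx := (mem_gtPatterns _ _ _).1 hx
    have hy := (mem_gtPatterns _ _ _).1 hy
    funext r i
    rcases eq_or_ne r (m + 1) with rfl | hne
    · rw [hx.2.1 _ _ (by omega), hy.2.1 _ _ (by omega)]
    · have := congrFun (congrFun hxy r) i
      simpa [Function.update_of_ne hne] using this
  · intro u _ v _ huv
    rw [Function.onFun, Finset.disjoint_left]
    intro z hz hz'
    obtain ⟨x, hx, rfl⟩ := Finset.mem_image.1 hz
    obtain ⟨y, hy, hxy⟩ := Finset.mem_image.1 hz'
    have hx := (mem_gtPatterns _ _ _).1 hx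
    have hy := (mem_gtPatterns _ _ _).1 hy
    refine huv (funext fun i => ?_)
    have := congrFun (congrFun hxy m) i
    rw [Function.update_of_ne (by omega), Function.update_of_ne (by omega)] at this
    rw [← hx.1, ← hy.1, this]

/-! ### Determinant formula for the number of patterns -/

theorem sum_Icc_choose_shift (a b i j : ℕ) (hab : a ≤ b) :
    ∑ u ∈ Finset.Icc a b, ((u + i).choose j : ℤ) =
      (b + i + 1).choose (j + 1) - (a + i).choose (j + 1) := by
  induction b, hab using Nat.le_induction with
  | base =>
    simp [Nat.choose_succ_succ]
  | succ b hab ih =>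
    rw [← Finset.insert_Icc_right_eq_Icc_add_one (by omega), Finset.sum_insert (by simp), ih,
      Nat.choose_succ_succ (b + 1 + i) j, show b + 1 + i = b + i + 1 by ring]
    push_cast
    ring

/-- Subtracting from each row its predecessor turns column `0`, which is all ones, into a unit
vector. By the hockey-stick identity the remaining minor has rows that are sums over the interlacing
intervals, and multilinearity pulls these sums out. -/
theorem det_choose_succ (m : ℕ) (l : Fin (m + 1) → ℕ) (hl : Monotone l) :
    (Matrix.of fun i j : Fin (m + 1) => ((l i + i).choose j : ℤ)).det =
      ∑ u ∈ Fintype.piFinset fun i : Fin m => Finset.Icc (l i.castSucc) (l i.succ),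
        (Matrix.of fun i j : Fin m => ((u i + i).choose j : ℤ)).det := by
  let B : Matrix (Fin (m + 1)) (Fin (m + 1)) ℤ := Matrix.of <| Fin.cons
    (fun j => ((l 0).choose j : ℤ))
    (fun (i : Fin m) (j : Fin (m + 1)) =>
      ((l i.succ + i + 1).choose j : ℤ) - ((l i.castSucc + i).choose j : ℤ))
  have hB : (Matrix.of fun i j : Fin (m + 1) => ((l i + i).choose j : ℤ)).det = B.det := by
    refine Matrix.det_eq_of_forall_row_eq_smul_add_pred (fun _ => 1) (fun j => ?_) fun i j => ?_
    · simp [B]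
    · simp [B, add_assoc]
  rw [hB, Matrix.det_succ_column_zero, Fin.sum_univ_succ, Finset.sum_eq_zero, add_zero]
  · have h := (Matrix.detRowAlternating (R := ℤ) (n := Fin m)).toMultilinearMap.map_sum_finset
      (fun (i : Fin m) (u : ℕ) => fun j : Fin m => ((u + i).choose j : ℤ))
      (fun i : Fin m => Finset.Icc (l i.castSucc) (l i.succ))
    refine Eq.trans ?_ h
    simp only [Fin.val_zero, pow_zero, one_mul]
    have : B 0 0 = 1 := by simp [B]
    rw [this, one_mul]
    change _ = Matrix.det _
    congr 1
    ext i j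
    rw [Finset.sum_apply, sum_Icc_choose_shift _ _ _ _ (hl (Fin.castSucc_lt_succ).le)]
    simp [B]
  · intro i _
    have : B i.succ 0 = 0 := by simp [B]
    rw [this]
    ring

/-- The number of Gelfand–Tsetlin patterns is a determinant of binomial coefficients. -/
theorem card_gtPatterns_eq_det (m : ℕ) (l : Fin m → ℕ) (hl : Monotone l) :
    ((gtPatterns m l).card : ℤ) = (Matrix.of fun i j : Fin m => ((l i + i).choose j : ℤ)).det := by
  induction m with
  | zero => simp [gtPatterns]
  | succ m ih =>
    rw [card_gtPatterns_succ, det_choose_succ m l hl, Nat.cast_sum]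
    refine Finset.sum_congr rfl fun u hu => ih u fun i j hij => ?_
    rw [Fintype.mem_piFinset] at hu
    rcases hij.eq_or_lt with rfl | hij
    · rfl
    · have h1 := Finset.mem_Icc.1 (hu i)
      have h2 := Finset.mem_Icc.1 (hu j)
      -- A row interlacing with a monotone row is monotone: `u i ≤ l (i + 1) ≤ l j ≤ u j` for `i <
      -- j`.
      exact h1.2.trans ((hl (show i.succ ≤ j.castSucc from hij)).trans h2.1)

/-! ### Evaluation of the determinant -/

theorem prod_Ioi_eq_prod_range (m : ℕ) (f : ℕ → ℕ → ℤ) :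
    ∏ i : Fin m, ∏ j ∈ Finset.Ioi i, f i j = ∏ j ∈ Finset.range m, ∏ i ∈ Finset.range j, f i j := by
  rw [Finset.prod_comm' (t' := Finset.univ) (s' := fun j : Fin m => Finset.Iio j) (by simp),
    ← Fin.prod_univ_eq_prod_range (fun j => ∏ i ∈ Finset.range j, f i j) m]
  refine Finset.prod_congr rfl fun j _ => ?_
  rw [← Nat.Iio_eq_range, ← Fin.map_valEmbedding_Iio, Finset.prod_map]
  rfl

/-- Scaling column `j` by `j!` gives values of the falling factorial of degree `j`, a monic
polynomial, so the determinant is Vandermonde. -/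
theorem prod_factorial_mul_det_choose (m : ℕ) (v : ℕ → ℕ) :
    (∏ i ∈ Finset.range m, (i.factorial : ℤ)) *
        (Matrix.of fun i j : Fin m => ((v i).choose j : ℤ)).det =
      ∏ j ∈ Finset.range m, ∏ i ∈ Finset.range j, ((v j : ℤ) - v i) := by
  rw [← prod_Ioi_eq_prod_range m fun i j => (v j : ℤ) - v i,
    ← Matrix.det_vandermonde fun i : Fin m => (v i : ℤ),
    Matrix.det_eval_matrixOfPolynomials_eq_det_vandermonde (fun i : Fin m => (v i : ℤ))
      (fun i => descPochhammer ℤ i) (fun i => descPochhammer_natDegree ℤ i)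
      (fun i => monic_descPochhammer ℤ i),
    ← Fin.prod_univ_eq_prod_range (fun i => (i.factorial : ℤ)) m]
  convert (Matrix.det_mul_row (fun i : Fin m => ((i : ℕ).factorial : ℤ))
    (Matrix.of fun i j : Fin m => ((v i).choose j : ℤ))).symm using 2
  ext i j
  simp only [Matrix.of_apply, descPochhammer_eval_eq_descFactorial,
    Nat.descFactorial_eq_factorial_mul_choose]
  push_cast
  rfl

theorem prod_range_cast_sub (j : ℕ) :
    ∏ i ∈ Finset.range j, ((j : ℤ) - i) = (j.factorial : ℤ) := by
  rw [← Nat.descFactorial_self, Nat.descFactorial_eq_prod_range, Nat.cast_prod]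
  refine Finset.prod_congr rfl fun i hi => ?_
  rw [Nat.cast_sub (Finset.mem_range.1 hi).le]

/-- The longest row of the Gelfand–Tsetlin patterns that encode plane partitions in a box. -/
def boxRow (n k t : ℕ) : Fin (t + k) → ℕ := fun i => if (i : ℕ) < t then 0 else n

theorem prod_factorial_mul_card_gtPatterns_boxRow (n k t : ℕ) :
    (∏ j ∈ Finset.range k, ((t + j).factorial : ℤ)) * (gtPatterns (t + k) (boxRow n k t)).card =
      ∏ j ∈ Finset.range k, (j.factorial * ((n + t + j).descFactorial t) : ℤ) := by
  have hmono : Monotone (boxRow n k t) := by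
    intro i j hij
    have : (i : ℕ) ≤ j := hij
    unfold boxRow
    split_ifs <;> omega
  have h := prod_factorial_mul_det_choose (t + k) fun i => (if i < t then 0 else n) + i
  have hd := card_gtPatterns_eq_det (t + k) (boxRow n k t) hmono
  simp only [boxRow] at hd
  rw [← hd, Finset.prod_range_add, Finset.prod_range_add, mul_assoc] at h
  have e1 : ∏ j ∈ Finset.range t, ∏ i ∈ Finset.range j,
      ((((if j < t then 0 else n) + j : ℕ) : ℤ) - ((if i < t then 0 else n) + i : ℕ)) =
      ∏ j ∈ Finset.range t, (j.factorial : ℤ) := by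
    refine Finset.prod_congr rfl fun j hj => ?_
    rw [← prod_range_cast_sub]
    refine Finset.prod_congr rfl fun i hi => ?_
    rw [Finset.mem_range] at hi hj
    simp [hj, hi.trans hj]
  have e2 : ∏ j ∈ Finset.range k, ∏ i ∈ Finset.range (t + j),
      ((((if t + j < t then 0 else n) + (t + j) : ℕ) : ℤ) - ((if i < t then 0 else n) + i : ℕ)) =
      ∏ j ∈ Finset.range k, (j.factorial * ((n + t + j).descFactorial t) : ℤ) := by
    refine Finset.prod_congr rfl fun j hj => ?_
    rw [Finset.prod_range_add, mul_comm]
    congr 1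
    · rw [← prod_range_cast_sub]
      refine Finset.prod_congr rfl fun i hi => ?_
      simp
    · rw [Nat.descFactorial_eq_prod_range, Nat.cast_prod]
      refine Finset.prod_congr rfl fun i hi => ?_
      rw [Finset.mem_range] at hi
      rw [Nat.cast_sub (by omega)]
      simp [hi]
      ring
  rw [e1, e2] at h
  -- Pairs of indices below `t` contribute the same factorials as the first `t` columns, and these
  -- cancel.
  refine mul_left_cancel₀ ?_ h
  exact Finset.prod_ne_zero_iff.2 fun i _ => by exact_mod_cast i.factorial_ne_zero

/-- The closed form for the number of plane partitions in a box. -/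
theorem card_gtPatterns_boxRow (n k t : ℕ) :
    ((gtPatterns (t + k) (boxRow n k t)).card : ℚ) =
      ∏ j ∈ Finset.range k,
        ((j.factorial : ℚ) / (t + j).factorial * ((n + t + j).descFactorial t : ℚ)) := by
  have h := prod_factorial_mul_card_gtPatterns_boxRow n k t
  have hne : ∏ j ∈ Finset.range k, ((t + j).factorial : ℚ) ≠ 0 :=
    Finset.prod_ne_zero_iff.2 fun i _ => by exact_mod_cast (t + i).factorial_ne_zero
  refine mul_left_cancel₀ hne ?_
  rw [← Finset.prod_mul_distrib]
  have h' : (∏ j ∈ Finset.range k, ((t + j).factorial : ℚ)) *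
      (gtPatterns (t + k) (boxRow n k t)).card =
      ∏ j ∈ Finset.range k, (j.factorial * ((n + t + j).descFactorial t) : ℚ) := by
    exact_mod_cast h
  rw [h']
  refine Finset.prod_congr rfl fun j _ => ?_
  have : ((t + j).factorial : ℚ) ≠ 0 := by exact_mod_cast (t + j).factorial_ne_zero
  field_simp

/-! ### Polynomiality and the stated product -/

theorem exists_polynomial_prod_descFactorial (k t : ℕ) :
    ∃ p : ℚ[X], ∀ n : ℕ, p.eval (n : ℚ) =
      ∏ j ∈ Finset.range k,
        ((j.factorial : ℚ) / (t + j).factorial * ((n + t + j).descFactorial t : ℚ)) := by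
  refine ⟨∏ j ∈ Finset.range k, (Polynomial.C ((j.factorial : ℚ) / (t + j).factorial) *
    (descPochhammer ℚ t).comp (Polynomial.X + Polynomial.C ((t : ℚ) + j))), fun n => ?_⟩
  rw [Polynomial.eval_prod]
  refine Finset.prod_congr rfl fun j _ => ?_
  rw [← descPochhammer_eval_eq_descFactorial]
  simp [add_assoc]

/-- For `1 ≤ c < k`, the factor `n + t + c` occurs in the quotients with `i < c`, hence `c` times in
all; the right side lists these powers with `c = k - i - 1`. -/
theorem prod_factorial_div_factorial (n k t : ℕ) :
    ∏ i ∈ Finset.range k, (((n + t + k - 1).factorial : ℚ) / (n + t + i).factorial) =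
      ∏ i ∈ Finset.range k, ((n : ℚ) + t + k - i - 1) ^ (k - i - 1) := by
  induction k with
  | zero => simp
  | succ k ih =>
    rcases Nat.eq_zero_or_pos k with rfl | hk
    · have : ((n + t).factorial : ℚ) ≠ 0 := by exact_mod_cast (n + t).factorial_ne_zero
      simp [this]
    have e : ∀ i ∈ Finset.range k, ((n + t + (k + 1) - 1).factorial : ℚ) / (n + t + i).factorial =
        ((n : ℚ) + t + k) * (((n + t + k - 1).factorial : ℚ) / (n + t + i).factorial) := by
      intro i _
      rw [show n + t + (k + 1) - 1 = (n + t + k - 1) + 1 by omega, Nat.factorial_succ,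
        show n + t + k - 1 + 1 = n + t + k by omega]
      push_cast
      ring
    have h1 : ((n + t + k).factorial : ℚ) ≠ 0 := by exact_mod_cast (n + t + k).factorial_ne_zero
    rw [Finset.prod_range_succ, Finset.prod_congr rfl e, Finset.prod_mul_distrib, ih,
      Finset.prod_range_succ', show n + t + (k + 1) - 1 = n + t + k by omega, div_self h1]
    simp only [Finset.prod_const, Finset.card_range, mul_one]
    rw [mul_comm]
    congr 1
    · refine Finset.prod_congr rfl fun i _ => ?_
      rw [show k + 1 - (i + 1) - 1 = k - i - 1 by omega]
      push_cast
      ring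
    · rw [show k + 1 - 0 - 1 = k by omega]
      push_cast
      ring

theorem prod_choose_mul_eq_prod_descFactorial (n k t : ℕ) :
    ∏ i ∈ Finset.range k, (((n + t + k - 1).choose (n + i) : ℚ) *
        ((i.factorial : ℚ) / ((n : ℚ) + t + k - i - 1) ^ (k - i - 1))) =
      ∏ j ∈ Finset.range k,
        ((j.factorial : ℚ) / (t + j).factorial * ((n + t + j).descFactorial t : ℚ)) := by
  have hf : ∀ m : ℕ, (m.factorial : ℚ) ≠ 0 := fun m => by exact_mod_cast m.factorial_ne_zero
  have hc : ∀ i ∈ Finset.range k, ((n + t + k - 1).choose (n + i) : ℚ) *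
      ((i.factorial : ℚ) / ((n : ℚ) + t + k - i - 1) ^ (k - i - 1)) =
      ((i.factorial : ℚ) / (n + i).factorial) *
        (((n + t + k - 1).factorial : ℚ) / ((n : ℚ) + t + k - i - 1) ^ (k - i - 1)) *
        (((t + (k - 1 - i)).factorial : ℚ))⁻¹ := by
    intro i hi
    rw [Finset.mem_range] at hi
    rw [Nat.cast_choose ℚ (show n + i ≤ n + t + k - 1 by omega),
      show n + t + k - 1 - (n + i) = t + (k - 1 - i) by omega]
    field_simp
  have hd : ∀ j ∈ Finset.range k,
      ((j.factorial : ℚ) / (t + j).factorial * ((n + t + j).descFactorial t : ℚ)) =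
      ((j.factorial : ℚ) / (n + j).factorial) * ((n + t + j).factorial : ℚ) *
        (((t + j).factorial : ℚ))⁻¹ := by
    intro j _
    have := Nat.factorial_mul_descFactorial (show t ≤ n + t + j by omega)
    rw [show n + t + j - t = n + j by omega] at this
    rw [← this]
    push_cast
    have := hf (n + j)
    field_simp
  rw [Finset.prod_congr rfl hc, Finset.prod_congr rfl hd]
  simp only [Finset.prod_mul_distrib]
  -- The binomials leave `(t + (k - 1 - i))!` in the denominator; only the product over all `i`
  -- matches, after reversing the index.
  rw [Finset.prod_range_reflect (fun i => ((t + i).factorial : ℚ)⁻¹) k]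
  congr 2
  rw [Finset.prod_div_distrib, ← prod_factorial_div_factorial, Finset.prod_div_distrib]
  exact div_div_cancel₀ (Finset.prod_ne_zero_iff.2 fun i _ => hf _)

/-! ### Patterns and labellings of the rectangle -/

theorem mem_rectDiagram {k t : ℕ} {c : ℕ × ℕ} : c ∈ rectDiagram k t ↔ c.1 < t ∧ c.2 < k := by
  simp [rectDiagram, YoungDiagram.mem_ofRowLens]

namespace IsGTPattern

variable {m : ℕ} {l : Fin m → ℕ} {x : ℕ → ℕ → ℕ}

theorem le_of_add_le (hx : IsGTPattern m l x) {r i : ℕ} (hi : i < r) (e : ℕ) (hr : r + e ≤ m) :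
    x (r + e) i ≤ x r i := by
  induction e with
  | zero => rfl
  | succ e ih => exact (hx.2.2 (r + e) i (by omega) (by omega)).1.trans (ih (by omega))

theorem le_diag_of_add_le (hx : IsGTPattern m l x) {r i : ℕ} (hi : i < r) (e : ℕ)
    (hr : r + e ≤ m) : x r i ≤ x (r + e) (i + e) := by
  induction e with
  | zero => rfl
  | succ e ih =>
    exact (ih (by omega)).trans (hx.2.2 (r + e) (i + e) (by omega) (by omega)).2

variable {n k t : ℕ}

theorem boxRow_apply (hx : IsGTPattern (t + k) (boxRow n k t) x) {i : ℕ} (hi : i < t + k) :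
    x (t + k) i = if i < t then 0 else n :=
  hx.1 ⟨i, hi⟩

theorem le_of_boxRow (hx : IsGTPattern (t + k) (boxRow n k t) x) {r i : ℕ} (hi : i < r)
    (hr : r ≤ t + k) : x r i ≤ n := by
  have h := hx.le_diag_of_add_le hi (t + k - r) (by omega)
  rw [show r + (t + k - r) = t + k by omega, hx.boxRow_apply (by omega)] at h
  split_ifs at h <;> omega

/-- The entries `n` of the bottom row bound the entry from both sides. With the region forced to
`0`, this leaves free exactly `i < t`, `i < r ≤ i + k`, a `t × k` rectangle with coordinates `(t - 1
- i, r - i - 1)`. -/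
theorem eq_of_boxRow (hx : IsGTPattern (t + k) (boxRow n k t) x) {r i : ℕ} (hi : i < r)
    (hr : r ≤ t + k) (hit : t ≤ i) : x r i = n := by
  refine (hx.le_of_boxRow hi hr).antisymm ?_
  have h := hx.le_of_add_le hi (t + k - r) (by omega)
  rwa [show r + (t + k - r) = t + k by omega, hx.boxRow_apply (by omega), if_neg (by omega)] at h

theorem eq_zero_of_boxRow (hx : IsGTPattern (t + k) (boxRow n k t) x) {r i : ℕ}
    (hr : r ≤ t + k) (hik : i + k < r) : x r i = 0 := by
  have h := hx.le_diag_of_add_le (show i < r by omega) (t + k - r) (by omega)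
  rw [show r + (t + k - r) = t + k by omega, hx.boxRow_apply (by omega), if_pos (by omega)] at h
  omega

end IsGTPattern

/-- The labels of the rectangle that a Gelfand–Tsetlin pattern contains. -/
def rectOfPattern (k t : ℕ) (x : ℕ → ℕ → ℕ) : FerrersPoset (rectDiagram k t) → ℤ :=
  fun c => x (t - (OrderDual.ofDual c).1.1 + (OrderDual.ofDual c).1.2)
    (t - 1 - (OrderDual.ofDual c).1.1)

/-- The Gelfand–Tsetlin pattern that contains a given labelling of the rectangle. -/
def patternOfRect (n k t : ℕ) (z : FerrersPoset (rectDiagram k t) → ℤ) : ℕ → ℕ → ℕ :=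
  fun r i =>
    if h : r ≤ t + k ∧ i < r then
      if hit : t ≤ i then n
      else if hik : i + k < r then 0
      else (z (OrderDual.toDual ⟨(t - 1 - i, r - i - 1),
        mem_rectDiagram.2 ⟨by simp only; omega, by simp only; omega⟩⟩)).toNat
    else 0

/-- The integer points of the dilated order polytope of a rectangle. -/
def boxLabellings (n k t : ℕ) : Set (FerrersPoset (rectDiagram k t) → ℤ) :=
  {z | (∀ a b, a < b → z a ≤ z b) ∧ ∀ a, 0 ≤ z a ∧ z a ≤ n}

theorem rectOfPattern_mem {n k t : ℕ} {x : ℕ → ℕ → ℕ}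
    (hx : IsGTPattern (t + k) (boxRow n k t) x) : rectOfPattern k t x ∈ boxLabellings n k t := by
  refine ⟨fun c d hcd => ?_, fun c => ?_⟩
  · induction c using OrderDual.rec with | _ c =>
    induction d using OrderDual.rec with | _ d =>
    obtain ⟨⟨a, b⟩, hc⟩ := c
    obtain ⟨⟨a', b'⟩, hd⟩ := d
    have hle : a' ≤ a ∧ b' ≤ b := (OrderDual.toDual_lt_toDual.1 hcd).le
    have hc := mem_rectDiagram.1 hc
    have hd := mem_rectDiagram.1 hd
    simp only at hc hd
    -- Changing the column of a cell keeps the pattern index `i`; changing its row moves along a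
    -- diagonal.
    have h1 := hx.le_of_add_le (show t - 1 - a < t - a + b' by omega) (b - b') (by omega)
    have h2 := hx.le_diag_of_add_le (show t - 1 - a < t - a + b' by omega) (a - a') (by omega)
    rw [show t - a + b' + (b - b') = t - a + b by omega] at h1
    rw [show t - a + b' + (a - a') = t - a' + b' by omega,
      show t - 1 - a + (a - a') = t - 1 - a' by omega] at h2
    exact Int.ofNat_le.2 (h1.trans h2)
  · have hc := mem_rectDiagram.1 (OrderDual.ofDual c).2
    exact ⟨Int.natCast_nonneg _, Int.ofNat_le.2 (hx.le_of_boxRow (by omega) (by omega))⟩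

theorem patternOfRect_rectOfPattern {n k t : ℕ} {x : ℕ → ℕ → ℕ}
    (hx : IsGTPattern (t + k) (boxRow n k t) x) : patternOfRect n k t (rectOfPattern k t x) = x := by
  funext r i
  unfold patternOfRect
  split_ifs with h hit hik
  · exact (hx.eq_of_boxRow h.2 h.1 hit).symm
  · exact (hx.eq_zero_of_boxRow h.1 hik).symm
  · simp only [rectOfPattern, OrderDual.ofDual_toDual, Int.toNat_natCast]
    congr 1 <;> [congr 1; skip] <;> omega
  · exact (hx.2.1 r i (by omega)).symm

theorem rectOfPattern_patternOfRect {n k t : ℕ} {z : FerrersPoset (rectDiagram k t) → ℤ}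
    (hz : z ∈ boxLabellings n k t) : rectOfPattern k t (patternOfRect n k t z) = z := by
  funext c
  have hc := mem_rectDiagram.1 (OrderDual.ofDual c).2
  rw [rectOfPattern, patternOfRect, dif_pos (by omega), dif_neg (by omega), dif_neg (by omega),
    Int.toNat_of_nonneg (hz.2 _).1]
  congr 1
  apply OrderDual.ofDual.injective
  refine Subtype.ext (Prod.ext ?_ ?_) <;> simp only [OrderDual.ofDual_toDual] <;> omega

theorem isGTPattern_patternOfRect {n k t : ℕ} {z : FerrersPoset (rectDiagram k t) → ℤ}
    (hz : z ∈ boxLabellings n k t) :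
    IsGTPattern (t + k) (boxRow n k t) (patternOfRect n k t z) := by
  have hmono : ∀ c d, c ≤ d → (z c).toNat ≤ (z d).toNat := fun c d hcd => by
    rcases hcd.eq_or_lt with rfl | h
    · rfl
    · exact Int.toNat_le_toNat (hz.1 c d h)
  have hle : ∀ c, (z c).toNat ≤ n := fun c => by
    have := hz.2 c
    omega
  refine ⟨fun i => ?_, fun r i hri => dif_neg (by omega), fun r i hi hr => ⟨?_, ?_⟩⟩
  · have := i.2
    simp only [patternOfRect, boxRow]
    split_ifs <;> omega
  · simp only [patternOfRect]
    split_ifs <;> first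
      | omega
      | exact hle _
      | (apply hmono
         refine OrderDual.toDual_le_toDual.2 (Subtype.mk_le_mk.2 (Prod.mk_le_mk.2 ⟨?_, ?_⟩)) <;>
          omega)
  · simp only [patternOfRect]
    split_ifs <;> first
      | omega
      | exact hle _
      | (apply hmono
         refine OrderDual.toDual_le_toDual.2 (Subtype.mk_le_mk.2 (Prod.mk_le_mk.2 ⟨?_, ?_⟩)) <;>
          omega)

theorem ncard_boxLabellings (n k t : ℕ) :
    (boxLabellings n k t).ncard = (gtPatterns (t + k) (boxRow n k t)).card := by
  have himage : boxLabellings n k t =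
      rectOfPattern k t '' (gtPatterns (t + k) (boxRow n k t) : Set (ℕ → ℕ → ℕ)) := by
    ext z
    simp only [Set.mem_image, Finset.mem_coe, mem_gtPatterns]
    constructor
    · exact fun hz => ⟨_, isGTPattern_patternOfRect hz, rectOfPattern_patternOfRect hz⟩
    · rintro ⟨x, hx, rfl⟩
      exact rectOfPattern_mem hx
  rw [himage, Set.InjOn.ncard_image, Set.ncard_coe_finset]
  intro x hx y hy hxy
  rw [Finset.mem_coe, mem_gtPatterns] at hx hy
  rw [← patternOfRect_rectOfPattern hx, hxy, patternOfRect_rectOfPattern hy]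

/-! ### Integer points of the dilates -/

theorem mem_natCast_smul_orderPolytope {P : Type*} [PartialOrder P] (n : ℕ) (z : P → ℤ) :
    (fun i => (z i : ℝ)) ∈ (n : ℝ) • orderPolytope P ↔
      (∀ a b, a < b → z a ≤ z b) ∧ ∀ a, 0 ≤ z a ∧ z a ≤ n := by
  rcases Nat.eq_zero_or_pos n with rfl | hn
  -- Scaling by `0` is not invertible; nonemptiness makes the dilate `{0}` rather than empty.
  · have hne : (orderPolytope P).Nonempty := ⟨0, by simp [orderPolytope]⟩
    rw [Nat.cast_zero, Set.zero_smul_set hne, Set.mem_zero]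
    constructor
    · intro h
      have h0 : ∀ a, z a = 0 := fun a => by
        have ha : (z a : ℝ) = 0 := congrFun h a
        exact_mod_cast ha
      simp [h0]
    · rintro ⟨-, h⟩
      funext a
      have := h a
      simp only [Pi.zero_apply, Int.cast_eq_zero]
      omega
  · have hn' : (0 : ℝ) < n := by exact_mod_cast hn
    rw [Set.mem_smul_set_iff_inv_smul_mem₀ hn'.ne']
    simp only [orderPolytope, Set.mem_ofPred_eq, Pi.smul_apply, smul_eq_mul]
    have h1 : ∀ a b, (n : ℝ)⁻¹ * z a ≤ (n : ℝ)⁻¹ * z b ↔ z a ≤ z b := fun a b => by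
      rw [mul_le_mul_iff_right₀ (inv_pos.2 hn'), Int.cast_le]
    have h2 : ∀ a, 0 ≤ (n : ℝ)⁻¹ * z a ↔ 0 ≤ z a := fun a => by
      rw [mul_nonneg_iff_of_pos_left (inv_pos.2 hn'), Int.cast_nonneg_iff]
    have h3 : ∀ a, (n : ℝ)⁻¹ * z a ≤ 1 ↔ z a ≤ n := fun a => by
      rw [inv_mul_le_one₀ hn']
      exact_mod_cast Iff.rfl
    simp only [h1, h2, h3]

theorem ehr_orderPolytope_rectDiagram (n k t : ℕ) :
    (ehr (orderPolytope (FerrersPoset (rectDiagram k t))) n : ℚ) =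
      ∏ j ∈ Finset.range k,
        ((j.factorial : ℚ) / (t + j).factorial * ((n + t + j).descFactorial t : ℚ)) := by
  rw [← card_gtPatterns_boxRow, ← ncard_boxLabellings]
  simp only [ehr, boxLabellings, mem_natCast_smul_orderPolytope]

theorem proposition5p13 (k t : ℕ) (hk : 1 ≤ k) :
    ∃ p : ℚ[X], IsEhrhartPolynomial (orderPolytope (FerrersPoset (rectDiagram k t))) p ∧
      ∀ n : ℕ,
        p.eval (n : ℚ) =
            ∏ i ∈ Finset.range k, (((n + t + k - 1).choose (n + i) : ℚ) *
              ((i.factorial : ℚ) / ((n : ℚ) + t + k - i - 1) ^ (k - i - 1))) ∧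
        (ehr (orderPolytope (FerrersPoset (rectDiagram k t))) n : ℚ) =
            ∏ i ∈ Finset.range k, (((n + t + k - 1).choose (n + i) : ℚ) *
              ((i.factorial : ℚ) / ((n : ℚ) + t + k - i - 1) ^ (k - i - 1))) := by
  obtain ⟨p, hp⟩ := exists_polynomial_prod_descFactorial k t
  refine ⟨p, fun n _ => ?_, fun n => ⟨?_, ?_⟩⟩
  · rw [hp, ehr_orderPolytope_rectDiagram]
  · rw [hp, prod_choose_mul_eq_prod_descFactorial]
  · rw [ehr_orderPolytope_rectDiagram, prod_choose_mul_eq_prod_descFactorial]
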